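/- Let $N\ge 2$, put $n=\lfloor (N+1)/2\rfloor$ (so $N=2n$ or $N=2n-1$), let $\hbar\in\mathbb{C}\setminus\{0\}$ and $p=\frac{\pi i}{2\hbar}$, and let $K$ be a field (for example $K=\mathbb{C}$, or a field of meromorphic functions or of rational functions in formal variables). Let $Q_1,\dots,Q_n:\mathbb{C}\to K$ be nowhere vanishing functions with $Q_a(u+\frac{\pi i}{\hbar})=h_aQ_a(u)$ for all $u$, for constants $h_a\in K$. Put $Y_0(u)=1$, $Y_a(u)=Q_a(u-1)/Q_a(u+1)$ for $1\le a\le n$, and, for odd $N$, $Y_n^{2}(u):=Y_n(u)\,Y_n(u+p)$ (the upper index is not a power). Define functions $x_1,\dots,x_{N+1}:\mathbb{C}\to K$ as follows. If $N=2n$: $$x_a(u)=\frac{Y_a(u+a)}{Y_{a-1}(u+a+1)},\qquad x_{n+1}(u)=\frac{Y_n(u+n+1+p)}{Y_n(u+n+2)},\qquad x_{2n+2-a}(u)=\frac{Y_{a-1}(u+2n-a+2+p)}{Y_a(u+2n-a+3+p)}\qquad(1\le a\le n).$$ If $N=2n-1$: $$x_a(u)=\frac{Y_a(u+a)}{Y_{a-1}(u+a+1)},\qquad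 x_{2n+1-a}(u)=\frac{Y_{a-1}(u+2n-a+1+p)}{Y_a(u+2n-a+2+p)}\qquad(1\le a\le n-1),$$ $$x_n(u)=\frac{Y_n^{2}(u+n)}{Y_{n-1}(u+n+1)},\qquad x_{n+1}(u)=\frac{Y_{n-1}(u+n+1+p)}{Y_n^{2}(u+n+2)}.$$ Let $D$ be the operator $(Df)(u)=f(u+2)$ on functions $f:\mathbb{C}\to K$, and let $$L(u)=(1-x_{N+1}(u)D)(1-x_N(u)D)\cdots(1-x_1(u)D)$$ be the difference operator attached to $U_q(A^{(2)}_N)$. Let $w_1,\dots,w_{N+1}$ be a basis, over the ring of $2$-periodic functions $\mathbb{C}\to K$, of the module of solutions $w:\mathbb{C}\to K$ of $L(u)w(u)=0$. For integers $i_1,\dots,i_{N+1}$ define the Casorati determinant, a function of $u$, $$[i_1,\dots,i_{N+1}]=\det\bigl(w_j(u+2i_k)\bigr)_{1\le j,k\le N+1},$$ and put, for $0\le a\le N+1$ and $m\in\mathbb{Z}$, $$\xi^{(a)}_m(u)=[0,1,\dots,a-1,a+m,a+m+1,\dots,N+m],\qquad \xi(u)=[0,1,\dots,N].$$ Then $\xi(u)\neq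 0$ for all $u\in\mathbb{C}$, and for all $a\in\{0,1,\dots,N+1\}$, $m\in\mathbb{Z}$ and $u\in\mathbb{C}$, $$\frac{\xi^{(a)}_m(u)}{\xi(u)}=\frac{\xi^{(N-a+1)}_m\left(u+2a-N-1+\frac{\pi i}{2\hbar}\right)}{\xi\left(u+2a-N-1+\frac{\pi i}{2\hbar}\right)}.$$ -/

import Mathlib

namespace TwistedA

/-- The ring of `2`-periodic functions `ℂ → K`: the constants of the shift `u ↦ u + 2`. -/
def periodicRing (K : Type*) [Field K] : Subring (ℂ → K) where
  carrier := {f | ∀ u, f (u + 2) = f u}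
  mul_mem' := by
    intro f g hf hg u
    simp only [Set.mem_ofPred_eq] at hf hg
    simp [hf u, hg u]
  one_mem' := by intro u; rfl
  add_mem' := by
    intro f g hf hg u
    simp only [Set.mem_ofPred_eq] at hf hg
    simp [hf u, hg u]
  zero_mem' := by intro u; rfl
  neg_mem' := by
    intro f hf u
    simp only [Set.mem_ofPred_eq] at hf
    simp [hf u]

/-- The difference operator `D`, `(D f)(u) = f (u + 2)`, acting on functions `ℂ → K`. -/
def shiftD (K : Type*) [Field K] : Module.End (periodicRing K) (ℂ → K) where
  toFun f := fun u => f (u + 2)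
  map_add' := by intro f g; rfl
  map_smul' := by
    intro c f
    funext u
    have h : (c : ℂ → K) (u + 2) = (c : ℂ → K) u := c.2 u
    change (c : ℂ → K) (u + 2) * f (u + 2) = (c : ℂ → K) u * f (u + 2)
    rw [h]

section Variables

variable {K : Type*} [Field K]

/-- The shift `π i / (2 ħ)`. -/
noncomputable def halfPeriod (ħ : ℂ) : ℂ := (Real.pi : ℂ) * Complex.I / (2 * ħ)

/-- `Y_a(u) = Q_a(u - 1) / Q_a(u + 1)` for `a ≥ 1` (every root of `A_N` has `(α|α) / 2 = 1`),
and `Y_0(u) = 1`. -/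
noncomputable def Y (Q : ℕ → ℂ → K) (a : ℕ) (u : ℂ) : K :=
  if a = 0 then 1 else Q a (u - 1) / Q a (u + 1)

/-- `Y_a^2(u) = Y_a(u) Y_a(u + π i / (2 ħ))`; the upper index is not a power. -/
noncomputable def Y2 (Q : ℕ → ℂ → K) (ħ : ℂ) (a : ℕ) (u : ℂ) : K :=
  Y Q a u * Y Q a (u + halfPeriod ħ)

/-- `z_a(u)`, `1 ≤ a ≤ n`, for `A^{(2)}_{2n}`. -/
noncomputable def zEven (Q : ℕ → ℂ → K) (a : ℕ) (u : ℂ) : K :=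
  Y Q a (u + a) / Y Q (a - 1) (u + a + 1)

/-- `z_0(u)` for `A^{(2)}_{2n}`. -/
noncomputable def zZero (Q : ℕ → ℂ → K) (ħ : ℂ) (n : ℕ) (u : ℂ) : K :=
  Y Q n (u + n + 1 + halfPeriod ħ) / Y Q n (u + n + 2)

/-- `z_{\bar a}(u)`, `1 ≤ a ≤ n`, for `A^{(2)}_{2n}`. -/
noncomputable def zBarEven (Q : ℕ → ℂ → K) (ħ : ℂ) (n a : ℕ) (u : ℂ) : K :=
  Y Q (a - 1) (u + 2 * n - a + 2 + halfPeriod ħ) / Y Q a (u + 2 * n - a + 3 + halfPeriod ħ)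

/-- `z_a(u)`, `1 ≤ a ≤ n`, for `A^{(2)}_{2n-1}`. -/
noncomputable def zOdd (Q : ℕ → ℂ → K) (ħ : ℂ) (n a : ℕ) (u : ℂ) : K :=
  if a = n then Y2 Q ħ n (u + n) / Y Q (n - 1) (u + n + 1)
  else Y Q a (u + a) / Y Q (a - 1) (u + a + 1)

/-- `z_{\bar a}(u)`, `1 ≤ a ≤ n`, for `A^{(2)}_{2n-1}`. -/
noncomputable def zBarOdd (Q : ℕ → ℂ → K) (ħ : ℂ) (n a : ℕ) (u : ℂ) : K :=
  if a = n then Y Q (n - 1) (u + n + 1 + halfPeriod ħ) / Y2 Q ħ n (u + n + 2)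
  else Y Q (a - 1) (u + 2 * n - a + 1 + halfPeriod ħ) / Y Q a (u + 2 * n - a + 2 + halfPeriod ħ)

/-- `x_a(u)`, `1 ≤ a ≤ 2n + 1`, for `A^{(2)}_{2n}`. -/
noncomputable def xEven (Q : ℕ → ℂ → K) (ħ : ℂ) (n a : ℕ) (u : ℂ) : K :=
  if a ≤ n then zEven Q a u
  else if a = n + 1 then zZero Q ħ n u
  else zBarEven Q ħ n (2 * n + 2 - a) u

/-- `x_a(u)`, `1 ≤ a ≤ 2n`, for `A^{(2)}_{2n-1}`. -/
noncomputable def xOdd (Q : ℕ → ℂ → K) (ħ : ℂ) (n a : ℕ) (u : ℂ) : K :=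
  if a ≤ n then zOdd Q ħ n a u
  else zBarOdd Q ħ n (2 * n + 1 - a) u

/-- The number `n` of orbits of the diagram automorphism of `A_N`:
`N = 2 n` or `N = 2 n - 1`. -/
def numOrbits (N : ℕ) : ℕ := (N + 1) / 2

/-- The variables `x_a(u)`, `1 ≤ a ≤ N + 1`, for `A^{(2)}_N`. -/
noncomputable def x (Q : ℕ → ℂ → K) (ħ : ℂ) (N a : ℕ) (u : ℂ) : K :=
  if Even N then xEven Q ħ (numOrbits N) a u else xOdd Q ħ (numOrbits N) a u

/-- The product `(1 - x_k(u) D) ⋯ (1 - x_2(u) D) (1 - x_1(u) D)`. -/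
noncomputable def LProd (Q : ℕ → ℂ → K) (ħ : ℂ) (N : ℕ) :
    ℕ → Module.End (periodicRing K) (ℂ → K)
  | 0 => 1
  | k + 1 => (1 - x Q ħ N (k + 1) • shiftD K) * LProd Q ħ N k

/-- The difference operator `L(u)` for `A^{(2)}_N`. -/
noncomputable def L (Q : ℕ → ℂ → K) (ħ : ℂ) (N : ℕ) : Module.End (periodicRing K) (ℂ → K) :=
  LProd Q ħ N (N + 1)

/-- The module, over the `2`-periodic functions, of the solutions `w` of `L(u) w(u) = 0`. -/
noncomputable def solutions (Q : ℕ → ℂ → K) (ħ : ℂ) (N : ℕ) :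
    Submodule (periodicRing K) (ℂ → K) :=
  LinearMap.ker (L Q ħ N)

/-- The Casorati determinant `[i_1, …, i_{N+1}]` at `u`: the determinant of the matrix
with `(j, k)` entry `w_j(u + 2 i_k)`. -/
noncomputable def casorati {N : ℕ} (w : Fin (N + 1) → ℂ → K) (i : Fin (N + 1) → ℤ) (u : ℂ) : K :=
  Matrix.det (Matrix.of fun j k => w j (u + 2 * (i k : ℂ)))

/-- `ξ^{(a)}_m(u) = [0, 1, …, a - 1, a + m, a + m + 1, …, N + m]`. -/
noncomputable def xiRect {N : ℕ} (w : Fin (N + 1) → ℂ → K) (a : ℕ) (m : ℤ) (u : ℂ) : K :=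
  casorati w (fun k => if (k : ℕ) < a then (k : ℤ) else (k : ℤ) + m) u

/-- `ξ(u) = [0, 1, …, N]`. -/
noncomputable def xi {N : ℕ} (w : Fin (N + 1) → ℂ → K) (u : ℂ) : K :=
  casorati w (fun k => (k : ℤ)) u

end Variables

end TwistedA

/-! Write M = N + 1, p = πi/(2ħ) and L = ∑ (-1)^k e_k(u) D^k. Extending the family by Y_{M-a}(u) =
Y_a(u + p), with Y_n^2 in the middle for odd N, gives every x_a the single form Y_a(u + a) /
Y_{a-1}(u + a + 1). This folding makes L self-dual, e_k(u + M + p) = e_{M-k}(u + 2k)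
(`shiftElem_x_dual`), so on each lattice u + 2ℤ the solutions shifted by M + p satisfy the adjoint
recurrence (`latticeValues_adjoint_recurrence`).

The bilinear concomitant of a recurrence and its adjoint is constant. Inverting it gives a pairing X
of adjoint vectors V' s with solution vectors V t, equal to 0 for 0 < t - s < M and to 1 for t - s =
M (`exists_pairing`). Two Gram determinants for this pairing are block triangular, each with one
unitriangular block, and they share the other block; each also factors as a Casorati determinant of
V', times det X, times one of V (`det_blocks_eq`).

In each product one Casorati factor is ξ, which is 2-periodic because e_M = 1 (`xi_add_two_mul_int`)
and nonzero by linear independence (`xi_ne_zero`). Dividing gives the identity. -/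

namespace TwistedA

/-! ### Coefficients of L and their self-duality -/

section Coefficients

variable {K : Type*} [Field K]

/-- The coefficient of `(-1) ^ k D ^ k` in `(1 - x_r D) ⋯ (1 - x_1 D)`. -/
def shiftElem (x : ℕ → ℂ → K) : ℕ → ℕ → ℂ → K
  | 0, 0, _ => 1
  | 0, _ + 1, _ => 0
  | _ + 1, 0, _ => 1
  | r + 1, k + 1, u => shiftElem x r (k + 1) u + x (r + 1) u * shiftElem x r k (u + 2)

@[simp]
theorem shiftElem_zero_right (x : ℕ → ℂ → K) (r : ℕ) (u : ℂ) : shiftElem x r 0 u = 1 := by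
  cases r <;> rfl

theorem shiftElem_succ_succ (x : ℕ → ℂ → K) (r k : ℕ) (u : ℂ) :
    shiftElem x (r + 1) (k + 1) u =
      shiftElem x r (k + 1) u + x (r + 1) u * shiftElem x r k (u + 2) := rfl

theorem shiftElem_eq_zero (x : ℕ → ℂ → K) {r k : ℕ} (h : r < k) (u : ℂ) :
    shiftElem x r k u = 0 := by
  induction r generalizing k u with
  | zero => obtain ⟨k, rfl⟩ := Nat.exists_eq_succ_of_ne_zero h.ne'; rfl
  | succ r ih =>
    obtain ⟨k, rfl⟩ := Nat.exists_eq_succ_of_ne_zero (Nat.ne_zero_of_lt h)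
    rw [Nat.succ_eq_add_one, shiftElem_succ_succ, ih (by omega), ih (by omega)]
    simp

theorem shiftElem_congr {x y : ℕ → ℂ → K} {r : ℕ}
    (h : ∀ a, 1 ≤ a → a ≤ r → ∀ u, x a u = y a u) (k : ℕ) (u : ℂ) :
    shiftElem x r k u = shiftElem y r k u := by
  induction r generalizing k u with
  | zero => cases k <;> rfl
  | succ r ih =>
    have ih' := ih fun a h1 h2 => h a h1 (by omega)
    cases k with
    | zero => rfl
    | succ k =>
      rw [shiftElem_succ_succ, shiftElem_succ_succ, ih', ih', h _ (by omega) le_rfl]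

/-- Expansion along the rightmost factor. -/
theorem shiftElem_succ_succ' (x : ℕ → ℂ → K) (r k : ℕ) (u : ℂ) :
    shiftElem x (r + 1) (k + 1) u =
      shiftElem (fun a => x (a + 1)) r (k + 1) u +
        shiftElem (fun a => x (a + 1)) r k u * x 1 (u + 2 * k) := by
  induction r generalizing k u with
  | zero => cases k <;> simp [shiftElem]
  | succ r ih =>
    rw [shiftElem_succ_succ, ih, shiftElem_succ_succ (fun a => x (a + 1))]
    cases k with
    | zero => simp; ring
    | succ k =>
      rw [ih, shiftElem_succ_succ (fun a => x (a + 1)) r k]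
      have : u + 2 + 2 * (k : ℂ) = u + 2 * ((k + 1 : ℕ) : ℂ) := by push_cast; ring
      rw [this]
      ring

theorem LProd_apply (Q : ℕ → ℂ → K) (ħ : ℂ) (N r : ℕ) (w : ℂ → K) (u : ℂ) :
    LProd Q ħ N r w u =
      ∑ k ∈ Finset.range (r + 1), (-1) ^ k * shiftElem (x Q ħ N) r k u * w (u + 2 * k) := by
  induction r generalizing u with
  | zero => simp [LProd]
  | succ r ih =>
    have h : LProd Q ħ N (r + 1) w u =
        LProd Q ħ N r w u - x Q ħ N (r + 1) u * LProd Q ħ N r w (u + 2) := rfl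
    rw [h, ih, ih, Finset.sum_range_succ' _ (r + 1)]
    simp only [shiftElem_succ_succ]
    rw [Finset.sum_range_succ' _ r, Finset.mul_sum]
    have h2 : ∑ k ∈ Finset.range (r + 1),
        (-1) ^ (k + 1) * shiftElem (x Q ħ N) r (k + 1) u * w (u + 2 * ((k + 1 : ℕ) : ℂ)) =
        ∑ k ∈ Finset.range r,
        (-1) ^ (k + 1) * shiftElem (x Q ħ N) r (k + 1) u * w (u + 2 * ((k + 1 : ℕ) : ℂ)) := by
      rw [Finset.sum_range_succ, shiftElem_eq_zero _ (Nat.lt_succ_self r)]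
      simp
    rw [← h2, add_sub_right_comm, ← Finset.sum_sub_distrib]
    congr 1
    · refine Finset.sum_congr rfl fun k _ => ?_
      have : u + 2 + 2 * (k : ℂ) = u + 2 * ((k + 1 : ℕ) : ℂ) := by push_cast; ring
      rw [this, pow_succ]
      ring
    · simp

/-- The variables `x_a(u) = Y_a(u + a) / Y_{a-1}(u + a + 1)` attached to a family `Y`. -/
def boxVar (Y : ℕ → ℂ → K) (a : ℕ) (u : ℂ) : K := Y a (u + a) / Y (a - 1) (u + a + 1)

/-- The top coefficient is x_r(u) x_{r-1}(u + 2) ⋯, which telescopes. -/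
theorem shiftElem_boxVar_self {Y : ℕ → ℂ → K} {M : ℕ} (hY0 : ∀ u, Y 0 u = 1)
    (hne : ∀ a ≤ M, ∀ u, Y a u ≠ 0) (r : ℕ) (hr : r ≤ M) (u : ℂ) :
    shiftElem (boxVar Y) r r u = Y r (u + r) := by
  induction r generalizing u with
  | zero => simp [hY0]
  | succ r ih =>
    rw [shiftElem_succ_succ, shiftElem_eq_zero _ (Nat.lt_succ_self r), ih (by omega), boxVar]
    have h : u + 2 + (r : ℂ) = u + ((r + 1 : ℕ) : ℂ) + 1 := by push_cast; ring
    have := hne r (by omega) (u + ((r + 1 : ℕ) : ℂ) + 1)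
    rw [h, Nat.add_sub_cancel, zero_add, div_mul_cancel₀ _ this]

/-- Interpolates towards the duality, which is the case r = M, where Y_M = 1. The induction peels
the rightmost factor off the last r variables and the leftmost factor off the first r; folding
matches the two expansions. -/
theorem shiftElem_boxVar_tail {Y : ℕ → ℂ → K} {M : ℕ} {p : ℂ} (hY0 : ∀ u, Y 0 u = 1)
    (hne : ∀ a ≤ M, ∀ u, Y a u ≠ 0) (hdual : ∀ a ≤ M, ∀ u, Y (M - a) (u + p) = Y a u)
    (r q : ℕ) (hrq : r + q = M) (j k : ℕ) (hjk : j + k = r) (u : ℂ) :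
    shiftElem (fun a => boxVar Y (a + q)) r k (u + M + p) * Y r (u + 2 * M - r + 2 * k) =
      shiftElem (boxVar Y) r j (u + 2 * M - 2 * r + 2 * k) := by
  induction r generalizing q j k u with
  | zero =>
    obtain ⟨rfl, rfl⟩ : j = 0 ∧ k = 0 := by omega
    simp [hY0]
  | succ r ih =>
    rcases Nat.eq_zero_or_pos k with rfl | hk
    · obtain rfl : j = r + 1 := by omega
      rw [shiftElem_boxVar_self hY0 hne _ (by omega), shiftElem_zero_right, one_mul]
      congr 1
      push_cast
      ring
    obtain ⟨k, rfl⟩ := Nat.exists_eq_succ_of_ne_zero hk.ne'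
    rw [Nat.succ_eq_add_one] at hjk ⊢
    -- Folding turns the peeled variable into Y_r / Y_{r+1}, whose denominator is cancelled by the
    -- factor Y_{r+1} of the statement.
    have hx : boxVar Y (1 + q) (u + M + p + 2 * k) =
        Y r (u + 2 * M - r + 2 * k) / Y (r + 1) (u + 2 * M - (r + 1 : ℕ) + 2 * (k + 1 : ℕ)) := by
      rw [boxVar]
      have hM : (M : ℂ) = r + 1 + q := by rw [← hrq]; push_cast; ring
      rw [← hdual r (by omega), ← hdual (r + 1) (by omega), show M - r = 1 + q by omega,
        show M - (r + 1) = 1 + q - 1 by omega]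
      congr 2 <;> push_cast <;> rw [hM] <;> ring
    have hne' := hne (r + 1) (by omega) (u + 2 * M - (r + 1 : ℕ) + 2 * (k + 1 : ℕ))
    have hfun : (fun a => boxVar Y (a + 1 + q)) = fun a => boxVar Y (a + (q + 1)) := by
      funext a; rw [add_right_comm, add_assoc]
    rw [shiftElem_succ_succ', hfun, hx]
    have hk1 := ih (q + 1) (by omega) j k (by omega) u
    rw [add_mul, mul_assoc, div_mul_cancel₀ _ hne', hk1]
    rcases j with _ | j
    · rw [shiftElem_eq_zero _ (by omega)]
      simp
    · have hk2 := ih (q + 1) (by omega) j (k + 1) (by omega) u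
      rw [shiftElem_succ_succ, boxVar, Nat.add_sub_cancel]
      have e1 : u + 2 * M - 2 * ((r + 1 : ℕ) : ℂ) + 2 * ((k + 1 : ℕ) : ℂ) + 2 =
          u + 2 * M - 2 * r + 2 * ((k + 1 : ℕ) : ℂ) := by push_cast; ring
      have e2 : u + 2 * M - 2 * ((r + 1 : ℕ) : ℂ) + 2 * ((k + 1 : ℕ) : ℂ) =
          u + 2 * M - 2 * r + 2 * k := by push_cast; ring
      have e3 : u + 2 * M - 2 * r + 2 * (k : ℂ) + ((r + 1 : ℕ) : ℂ) =
          u + 2 * M - ((r + 1 : ℕ) : ℂ) + 2 * ((k + 1 : ℕ) : ℂ) := by push_cast; ring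
      have e4 : u + 2 * M - ((r + 1 : ℕ) : ℂ) + 2 * ((k + 1 : ℕ) : ℂ) + 1 =
          u + 2 * M - r + 2 * ((k + 1 : ℕ) : ℂ) := by push_cast; ring
      have hne2 := hne r (by omega) (u + 2 * M - r + 2 * ((k + 1 : ℕ) : ℂ))
      rw [e1, ← hk2, e2, e3, e4, mul_comm _ (Y r _), ← mul_assoc, div_mul_cancel₀ _ hne2]
      ring

/-- The duality `e_k(u + M + p) = e_{M-k}(u + 2k)` of the coefficients. -/
theorem shiftElem_boxVar_dual {Y : ℕ → ℂ → K} {M : ℕ} {p : ℂ} (hY0 : ∀ u, Y 0 u = 1)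
    (hne : ∀ a ≤ M, ∀ u, Y a u ≠ 0) (hdual : ∀ a ≤ M, ∀ u, Y (M - a) (u + p) = Y a u)
    (j k : ℕ) (hjk : j + k = M) (u : ℂ) :
    shiftElem (boxVar Y) M k (u + M + p) = shiftElem (boxVar Y) M j (u + 2 * k) := by
  have h := shiftElem_boxVar_tail hY0 hne hdual M 0 (by omega) j k hjk u
  have hYM : ∀ u, Y M u = 1 := fun u => by
    rw [← hdual M le_rfl, Nat.sub_self, hY0]
  rw [hYM, mul_one] at h
  simpa [add_sub_cancel_right] using h

/-- The family `Y_a`, `0 ≤ a ≤ N + 1`, extended by `Y_{N+1-a}(u) = Y_a(u + π i / (2 ħ))`. -/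
noncomputable def foldedY (Q : ℕ → ℂ → K) (ħ : ℂ) (N a : ℕ) (u : ℂ) : K :=
  if 2 * a < N + 1 then Y Q a u
  else if 2 * a = N + 1 then Y2 Q ħ a u
  else Y Q (N + 1 - a) (u + halfPeriod ħ)

theorem Y_zero (Q : ℕ → ℂ → K) (u : ℂ) : Y Q 0 u = 1 := if_pos rfl

theorem Y_ne_zero {Q : ℕ → ℂ → K} {n : ℕ} (hQ : ∀ a, 1 ≤ a → a ≤ n → ∀ u, Q a u ≠ 0)
    (a : ℕ) (ha : a ≤ n) (u : ℂ) : Y Q a u ≠ 0 := by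
  rw [Y]
  split_ifs with h
  · exact one_ne_zero
  · exact div_ne_zero (hQ a (by omega) ha _) (hQ a (by omega) ha _)

/-- The multiplier h_a cancels in the quotient; it is nonzero because Q_a never vanishes. -/
theorem Y_add_halfPeriod_add_halfPeriod {Q : ℕ → ℂ → K} {n : ℕ} {ħ : ℂ}
    (hQ : ∀ a, 1 ≤ a → a ≤ n → ∀ u, Q a u ≠ 0)
    (hper : ∀ a, 1 ≤ a → a ≤ n →
      ∃ h : K, ∀ u, Q a (u + (Real.pi : ℂ) * Complex.I / ħ) = h * Q a u)
    (a : ℕ) (ha : a ≤ n) (u : ℂ) : Y Q a (u + halfPeriod ħ + halfPeriod ħ) = Y Q a u := by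
  rw [Y, Y]
  split_ifs with h0
  · rfl
  obtain ⟨h, hh⟩ := hper a (by omega) ha
  have e : halfPeriod ħ + halfPeriod ħ = (Real.pi : ℂ) * Complex.I / ħ := by
    rw [halfPeriod, mul_comm (2 : ℂ) ħ, ← div_div, add_halves]
  have hne : h ≠ 0 := fun h0 => by
    have := hh 0
    rw [h0, zero_mul] at this
    exact hQ a (by omega) ha _ this
  have e1 : u + halfPeriod ħ + halfPeriod ħ - 1 = u - 1 + (Real.pi : ℂ) * Complex.I / ħ := by
    rw [← e]; ring
  have e2 : u + halfPeriod ħ + halfPeriod ħ + 1 = u + 1 + (Real.pi : ℂ) * Complex.I / ħ := by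
    rw [← e]; ring
  rw [e1, e2, hh, hh, mul_div_mul_left _ _ hne]

theorem foldedY_zero (Q : ℕ → ℂ → K) (ħ : ℂ) (N : ℕ) (u : ℂ) : foldedY Q ħ N 0 u = 1 := by
  rw [foldedY, if_pos (by omega), Y_zero]

theorem foldedY_ne_zero {Q : ℕ → ℂ → K} {ħ : ℂ} {N : ℕ}
    (hQ : ∀ a, 1 ≤ a → a ≤ numOrbits N → ∀ u, Q a u ≠ 0)
    (a : ℕ) (u : ℂ) : foldedY Q ħ N a u ≠ 0 := by
  rw [foldedY]
  have := Y_ne_zero hQ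
  unfold numOrbits at this
  split_ifs with h1 h2
  · exact this _ (by omega) _
  · exact mul_ne_zero (this _ (by omega) _) (this _ (by omega) _)
  · exact this _ (by omega) _

theorem foldedY_dual {Q : ℕ → ℂ → K} {ħ : ℂ} {N : ℕ}
    (hQ : ∀ a, 1 ≤ a → a ≤ numOrbits N → ∀ u, Q a u ≠ 0)
    (hper : ∀ a, 1 ≤ a → a ≤ numOrbits N →
      ∃ h : K, ∀ u, Q a (u + (Real.pi : ℂ) * Complex.I / ħ) = h * Q a u)
    (a : ℕ) (ha : a ≤ N + 1) (u : ℂ) :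
    foldedY Q ħ N (N + 1 - a) (u + halfPeriod ħ) = foldedY Q ħ N a u := by
  have hp := Y_add_halfPeriod_add_halfPeriod hQ hper
  unfold numOrbits at hp
  rw [foldedY, foldedY]
  rcases lt_trichotomy (2 * a) (N + 1) with h | h | h
  · rw [if_neg (by omega), if_neg (by omega), if_pos h, Nat.sub_sub_self ha, hp _ (by omega)]
  · rw [if_neg (by omega), if_pos (by omega), if_neg (by omega), if_pos h,
      show N + 1 - a = a by omega, Y2, Y2, hp _ (by omega), mul_comm]
  · rw [if_pos (by omega), if_neg (by omega), if_neg (by omega)]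

theorem x_eq_boxVar (Q : ℕ → ℂ → K) (ħ : ℂ) (N a : ℕ) (h1 : 1 ≤ a) (h2 : a ≤ N + 1)
    (u : ℂ) : x Q ħ N a u = boxVar (foldedY Q ħ N) a u := by
  obtain ⟨b, rfl⟩ : ∃ b, a = b + 1 := ⟨a - 1, by omega⟩
  rw [x, boxVar, Nat.add_sub_cancel]
  split_ifs with hN
  · obtain ⟨n, rfl⟩ := hN
    have hn : numOrbits (n + n) = n := by unfold numOrbits; omega
    rw [hn, xEven]
    split_ifs with h3 h4
    · rw [zEven, foldedY, foldedY, if_pos (by omega), if_pos (by omega), Nat.add_sub_cancel]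
    · obtain rfl : b = n := by omega
      rw [zZero, foldedY, foldedY, if_neg (by omega), if_neg (by omega), if_pos (by omega),
        show b + b + 1 - (b + 1) = b by omega]
      congr 2 <;> push_cast <;> ring
    · rw [zBarEven, foldedY, foldedY, if_neg (by omega), if_neg (by omega), if_neg (by omega),
        if_neg (by omega), show 2 * n + 2 - (b + 1) - 1 = n + n + 1 - (b + 1) by omega,
        show n + n + 1 - b = 2 * n + 2 - (b + 1) by omega, Nat.cast_sub (by omega)]
      congr 2 <;> push_cast <;> ring
  · obtain ⟨k, rfl⟩ := Nat.not_even_iff_odd.mp hN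
    have hn : numOrbits (2 * k + 1) = k + 1 := by unfold numOrbits; omega
    rw [hn, xOdd]
    split_ifs with h3
    · rw [zOdd, foldedY, foldedY, if_pos (show 2 * b < _ by omega)]
      split_ifs with h4
      all_goals first | omega | skip
      · rw [h4, show b = k by omega]; simp
      · rw [Nat.add_sub_cancel]
    · by_cases hb : b = k + 1
      · subst hb
        rw [zBarOdd, if_pos (by omega), foldedY, if_neg (by omega), if_neg (by omega), foldedY,
          if_neg (by omega), if_pos (by omega),
          show 2 * k + 1 + 1 - (k + 1 + 1) = k + 1 - 1 by omega]
        congr 2 <;> push_cast <;> ring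
      · rw [zBarOdd, if_neg (by omega), foldedY, if_neg (by omega), if_neg (by omega), foldedY,
          if_neg (by omega), if_neg (by omega),
          show 2 * (k + 1) + 1 - (b + 1) - 1 = 2 * k + 1 + 1 - (b + 1) by omega,
          show 2 * (k + 1) + 1 - (b + 1) = 2 * k + 1 + 1 - b by omega, Nat.cast_sub (by omega)]
        congr 2 <;> push_cast <;> ring

end Coefficients

/-! ### Linear recurrences on ℤ, their adjoints, and minors -/

section Sequences

variable {K : Type*} [Field K]

/-- The bilinear concomitant of a linear recurrence of order `M` and its adjoint. -/
def concomitant (M : ℕ) (d : ℕ → ℤ → K) (y z : ℤ → K) (i : ℤ) : K :=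
  ∑ r ∈ Finset.range M, ∑ s ∈ Finset.range M,
    z (i - 1 - r) * d (r + 1 + s) (i - 1 - r) * y (i + s)

/-- The concomitant sums the terms z(j) d_k(j) y(j + k) with j < i ≤ j + k. Moving the cut i by one
adds a row and removes a column of the array `h`; the row sum is the recurrence, the column sum its
adjoint, and both vanish. -/
theorem concomitant_add_one {M : ℕ} {d : ℕ → ℤ → K} (hd : ∀ k, M < k → ∀ i, d k i = 0)
    {y z : ℤ → K} (hy : ∀ i, ∑ k ∈ Finset.range (M + 1), d k i * y (i + k) = 0)
    (hz : ∀ i : ℤ, ∑ k ∈ Finset.range (M + 1), d k (i - k) * z (i - k) = 0) (i : ℤ) :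
    concomitant M d y z (i + 1) = concomitant M d y z i := by
  set h : ℕ → ℕ → K := fun r s => z (i - r) * d (r + s) (i - r) * y (i + s) with hh
  have hzero : ∀ r s, M < r + s → h r s = 0 := fun r s hrs => by simp [hh, hd _ hrs]
  have h1 : concomitant M d y z (i + 1) + ∑ r ∈ Finset.range (M + 1), h r 0 =
      ∑ r ∈ Finset.range (M + 1), ∑ s ∈ Finset.range (M + 1), h r s := by
    have hM : ∑ s ∈ Finset.range M, h M (s + 1) = 0 :=
      Finset.sum_eq_zero fun s _ => hzero _ _ (by omega)
    simp only [fun r => Finset.sum_range_succ' (h r) M]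
    rw [Finset.sum_add_distrib, Finset.sum_range_succ _ M, Finset.sum_range_succ _ M, hM, add_zero,
      add_left_inj, concomitant]
    refine Finset.sum_congr rfl fun r _ => Finset.sum_congr rfl fun s _ => ?_
    rw [hh]
    dsimp only
    rw [show i + 1 - 1 - (r : ℤ) = i - r by ring, show r + 1 + s = r + (s + 1) by ring,
      show i + 1 + (s : ℤ) = i + ((s + 1 : ℕ) : ℤ) by push_cast; ring]
  have h2 : concomitant M d y z i + ∑ s ∈ Finset.range (M + 1), h 0 s =
      ∑ r ∈ Finset.range (M + 1), ∑ s ∈ Finset.range (M + 1), h r s := by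
    rw [Finset.sum_range_succ' (fun r => ∑ s ∈ Finset.range (M + 1), h r s) M, concomitant]
    congr 1
    refine Finset.sum_congr rfl fun r _ => ?_
    rw [Finset.sum_range_succ, hzero (r + 1) M (by omega), add_zero]
    refine Finset.sum_congr rfl fun s _ => ?_
    rw [hh]
    dsimp only
    rw [show i - 1 - (r : ℤ) = i - ((r + 1 : ℕ) : ℤ) by push_cast; ring]
  have h3 : ∑ r ∈ Finset.range (M + 1), h r 0 = 0 := by
    calc _ = (∑ k ∈ Finset.range (M + 1), d k (i - k) * z (i - k)) * y i := by
          rw [Finset.sum_mul]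
          refine Finset.sum_congr rfl fun r _ => ?_
          simp [hh, mul_comm]
      _ = 0 := by rw [hz, zero_mul]
  have h4 : ∑ s ∈ Finset.range (M + 1), h 0 s = 0 := by
    calc _ = z i * ∑ k ∈ Finset.range (M + 1), d k i * y (i + k) := by
          rw [Finset.mul_sum]
          refine Finset.sum_congr rfl fun r _ => ?_
          simp [hh, mul_assoc]
      _ = 0 := by rw [hy, mul_zero]
  rw [h3, add_zero] at h1
  rw [h4, add_zero] at h2
  rw [h1, h2]

theorem eq_of_add_one_eq {α : Type*} {f : ℤ → α} (h : ∀ i, f (i + 1) = f i) (i j : ℤ) :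
    f i = f j := by
  have h0 : ∀ i, f i = f 0 := fun i => by
    induction i using Int.induction_on with
    | zero => rfl
    | succ n ih => rw [h, ih]
    | pred n ih => rw [← h, sub_add_cancel, ih]
  rw [h0 i, h0 j]

/-- The matrix whose columns are the vectors `V (p k)`. -/
def colMatrix {M : ℕ} (V : ℤ → Fin M → K) (p : Fin M → ℤ) : Matrix (Fin M) (Fin M) K :=
  Matrix.of fun j k => V (p k) j

theorem exists_pairing {M : ℕ} {d : ℕ → ℤ → K} (hd : ∀ k, M < k → ∀ i, d k i = 0)
    (hdM : ∀ i, d M i ≠ 0) (hdc : ∀ i j, d M i = d M j) (hMpos : 0 < M)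
    {V V' : ℤ → Fin M → K}
    (hV : ∀ j i, ∑ k ∈ Finset.range (M + 1), d k i * V (i + k) j = 0)
    (hV' : ∀ j, ∀ i : ℤ, ∑ k ∈ Finset.range (M + 1), d k (i - k) * V' (i - k) j = 0)
    (hdet : ∀ i : ℤ, (colMatrix V fun k => i + k).det ≠ 0)
    (hdet' : ∀ i : ℤ, (colMatrix V' fun k => i + k).det ≠ 0) :
    ∃ X : Matrix (Fin M) (Fin M) K, X.det ≠ 0 ∧
      (∀ s t : ℤ, 1 ≤ t - s → t - s < M → V' s ⬝ᵥ X.mulVec (V t) = 0) ∧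
      ∀ s : ℤ, V' s ⬝ᵥ X.mulVec (V (s + M)) = 1 := by
  set S : ℤ → Matrix (Fin M) (Fin M) K := fun i =>
    Matrix.of fun s r => d (M - r + s) (i - M + r) with hS
  set C : Matrix (Fin M) (Fin M) K := Matrix.of fun j l =>
    concomitant M d (fun i => V i j) (fun i => V' i l) 0 with hC
  -- By constancy C can be evaluated at any cut i. Reversing the order of r makes the middle factor
  -- upper triangular with diagonal d_M.
  have hfac : ∀ i : ℤ, C = (colMatrix V fun k => i + k) * S i *
      (colMatrix V' fun k => i - M + k).transpose := fun i => by
    ext j l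
    have hc := eq_of_add_one_eq
      (concomitant_add_one hd (y := fun i => V i j) (z := fun i => V' i l) (hV j) (hV' l)) 0 i
    rw [hC, Matrix.of_apply, hc, concomitant, ← Finset.sum_range_reflect, Finset.sum_range,
      Matrix.mul_apply]
    refine Finset.sum_congr rfl fun r _ => ?_
    rw [Finset.sum_range, Matrix.mul_apply, Finset.sum_mul]
    refine Finset.sum_congr rfl fun s _ => ?_
    have hr := r.2
    have e1 : ((M - 1 - r : ℕ) : ℤ) = M - 1 - r := by omega
    rw [e1, show M - 1 - (r : ℕ) + 1 + s = M - r + s by omega,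
      show i - 1 - ((M : ℤ) - 1 - r) = i - M + r by ring]
    simp only [colMatrix, hS, Matrix.of_apply, Matrix.transpose_apply]
    ring
  have hSdet : (S 0).det ≠ 0 := by
    rw [Matrix.det_of_isUpperTriangular]
    · refine Finset.prod_ne_zero_iff.mpr fun r _ => ?_
      have hr := r.2
      simp only [hS, Matrix.of_apply]
      rw [show M - (r : ℕ) + r = M by omega]
      exact hdM _
    · intro s r hrs
      have hrs' : (r : ℕ) < s := hrs
      have hr := r.2
      exact hd _ (by omega) _
  have hCdet : C.det ≠ 0 := by
    rw [hfac 0, Matrix.det_mul, Matrix.det_mul, Matrix.det_transpose]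
    exact mul_ne_zero (mul_ne_zero (hdet _) hSdet) (hdet' _)
  have hCu : IsUnit C.det := hCdet.isUnit
  -- The vector f with V'(i - M + r) ⬝ f = δ_{r0} satisfies C f = d_M V(i), since the first column
  -- of `S i` is d_M e_0. Hence f = d_M C⁻¹ V(i).
  have key : ∀ (i : ℤ) (r : Fin M),
      V' (i - M + r) ⬝ᵥ (d M 0 • C⁻¹).mulVec (V i) = if (r : ℕ) = 0 then 1 else 0 := by
    intro i r
    set W' := colMatrix V' fun k => i - M + k with hW'
    have hWu : IsUnit W'.transpose.det := by
      rw [Matrix.det_transpose]; exact (hdet' _).isUnit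
    set o : Fin M := ⟨0, hMpos⟩
    set f := W'.transpose⁻¹.mulVec (Pi.single o 1) with hf
    have h1 : W'.transpose.mulVec f = Pi.single o 1 := by
      rw [hf, Matrix.mulVec_mulVec, Matrix.mul_nonsing_inv _ hWu, Matrix.one_mulVec]
    have h2 : C.mulVec f = d M 0 • V i := by
      rw [hfac i, ← Matrix.mulVec_mulVec, h1, ← Matrix.mulVec_mulVec, Matrix.mulVec_single_one]
      have h3 : (S i).col o = Pi.single o (d M 0) := by
        funext s
        simp only [Matrix.col_apply, hS, Matrix.of_apply, Pi.single_apply]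
        split_ifs with hs
        · subst hs
          simp [o, hdc _ 0]
        · have : (s : ℕ) ≠ 0 := fun h => hs (Fin.ext h)
          exact hd _ (by simp only [o]; omega) _
      rw [h3, Matrix.mulVec_single]
      funext j
      simp [colMatrix, o, mul_comm]
    have h4 : (d M 0 • C⁻¹).mulVec (V i) = f := by
      rw [Matrix.smul_mulVec, ← Matrix.mulVec_smul, ← h2, Matrix.mulVec_mulVec,
        Matrix.nonsing_inv_mul _ hCu, Matrix.one_mulVec]
    have h5 := congrFun h1 r
    rw [h4]
    simp only [Matrix.mulVec, Pi.single_apply] at h5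
    refine Eq.trans h5 ?_
    simp [o, Fin.ext_iff]
  refine ⟨d M 0 • C⁻¹, ?_, fun s t h1 h2 => ?_, fun s => ?_⟩
  · rw [Matrix.det_smul]
    refine mul_ne_zero (pow_ne_zero _ (hdM 0)) ?_
    rw [Matrix.det_nonsing_inv]
    exact hCu.ringInverse.ne_zero
  · have := key t ⟨((M : ℤ) - (t - s)).toNat, by omega⟩
    rw [if_neg (by simp only; omega)] at this
    rw [← this]
    congr 2
    simp only
    omega
  · have := key (s + M) ⟨0, hMpos⟩
    simpa using this

theorem det_gram {M : ℕ} (V V' : ℤ → Fin M → K) (X : Matrix (Fin M) (Fin M) K)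
    (p q : Fin M → ℤ) :
    (Matrix.of fun r s => V' (p r) ⬝ᵥ X.mulVec (V (q s))).det =
      (colMatrix V' p).det * X.det * (colMatrix V q).det := by
  rw [← Matrix.det_transpose (colMatrix V' p), ← Matrix.det_mul, ← Matrix.det_mul,
    Matrix.mul_assoc]
  rfl

/-- Minors of two blocks of consecutive vectors of a recurrence and of its adjoint. -/
theorem det_blocks_eq {M : ℕ} {V V' : ℤ → Fin M → K} {X : Matrix (Fin M) (Fin M) K}
    (hX : X.det ≠ 0) (h0 : ∀ s t : ℤ, 1 ≤ t - s → t - s < M → V' s ⬝ᵥ X.mulVec (V t) = 0)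
    (h1 : ∀ s : ℤ, V' s ⬝ᵥ X.mulVec (V (s + M)) = 1) (a : ℕ) (ha : a ≤ M) (m : ℤ) :
    (colMatrix V' fun k => -M + k).det *
        (colMatrix V fun k => if (k : ℕ) < a then (k : ℤ) else k + m).det =
      (colMatrix V' fun k => a - M + if (k : ℕ) < M - a then (k : ℤ) else k + m).det *
        (colMatrix V fun k => a + m + k).det := by
  have g1 := det_gram V V' X (fun k => -M + k) fun k => if (k : ℕ) < a then (k : ℤ) else k + m
  have g2 := det_gram V V' X
    (fun k => a - M + if (k : ℕ) < M - a then (k : ℤ) else k + m) fun k => a + m + k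
  -- The unitriangular block is the first one in `g1` (size a) and the second one in `g2`. The
  -- remaining blocks, of size M - a, agree after a shift of indices by a.
  rw [Matrix.twoBlockTriangular_det _ fun k : Fin M => (k : ℕ) < a] at g1
  rw [Matrix.twoBlockTriangular_det _ fun k : Fin M => (k : ℕ) < M - a] at g2
  · rw [Matrix.det_of_isUpperTriangular, Finset.prod_eq_one, one_mul] at g1
    · rw [mul_comm, Matrix.det_of_isUpperTriangular, Finset.prod_eq_one, one_mul] at g2
      · let e : {k : Fin M // ¬ (k : ℕ) < a} ≃ {k : Fin M // (k : ℕ) < M - a} :=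
          { toFun := fun k => ⟨⟨k.1 - a, by omega⟩, by have := k.1.2; have := k.2; simp only; omega⟩
            invFun := fun k => ⟨⟨k.1 + a, by omega⟩, by simp⟩
            left_inv := fun k => by
              have := k.2
              ext
              simp only
              omega
            right_inv := fun k => by ext; simp }
        rw [← Matrix.det_submatrix_equiv_self e] at g2
        refine mul_left_cancel₀ hX ?_
        have hP := g1.symm.trans ((congrArg Matrix.det ?_).trans g2)
        · linear_combination hP
        · ext k l
          have hk := k.2
          have hl := l.2
          simp only [Matrix.toSquareBlockProp_def, Matrix.of_apply, Matrix.submatrix_apply, e,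
            Equiv.coe_fn_mk]
          have h3 : (k : ℕ) - a < M - a := by omega
          rw [if_neg hl, if_pos h3,
            show (a : ℤ) - M + ((k : ℕ) - a : ℕ) = -M + (k : ℕ) by omega,
            show a + m + ((l : ℕ) - a : ℕ) = (l : ℕ) + m by omega]
      · rintro ⟨k, hk⟩ -
        simp only [Matrix.toSquareBlockProp_def, Matrix.of_apply, if_neg hk]
        rw [← h1]
        congr 3
        ring
      · rintro ⟨k, hk⟩ ⟨l, hl⟩ hkl
        have hkl' : (l : ℕ) < k := hkl
        simp only [Matrix.toSquareBlockProp_def, Matrix.of_apply, if_neg hk]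
        refine h0 _ _ ?_ ?_ <;> omega
    · rintro ⟨k, hk⟩ -
      simp only [Matrix.toSquareBlockProp_def, Matrix.of_apply, if_pos hk]
      rw [← h1]
      congr 3
      ring
    · rintro ⟨k, hk⟩ ⟨l, hl⟩ hkl
      have hkl' : (l : ℕ) < k := hkl
      simp only [Matrix.toSquareBlockProp_def, Matrix.of_apply, if_pos hl]
      refine h0 _ _ ?_ ?_ <;> omega
  · intro k hk l hl
    simp only [Matrix.of_apply, if_neg hk]
    refine h0 _ _ ?_ ?_ <;> omega
  · intro k hk l hl
    simp only [Matrix.of_apply, if_pos hl]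
    refine h0 _ _ ?_ ?_ <;> omega

/-- The recurrence replaces V(i) by -d_M V(i + M) modulo the other columns; the factor -d_M = (-1)^N
cancels the sign of the cyclic permutation of the columns. -/
theorem det_consecutive {N : ℕ} {d : ℕ → ℤ → K} (hd0 : ∀ i, d 0 i = 1)
    (hdM : ∀ i, d (N + 1) i = (-1) ^ (N + 1)) {V : ℤ → Fin (N + 1) → K}
    (hV : ∀ j i, ∑ k ∈ Finset.range (N + 1 + 1), d k i * V (i + k) j = 0) (i : ℤ) :
    (colMatrix V fun k => i + 1 + k).det = (colMatrix V fun k => i + k).det := by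
  set A : Matrix (Fin (N + 1)) (Fin (N + 1)) K := Matrix.of fun j =>
    Fin.cons (V (i + (N + 1 : ℕ)) j) fun k : Fin N => V (i + (k + 1 : ℕ)) j with hA
  have h1 : (colMatrix V fun k => i + 1 + k) = A.submatrix id (finRotate (N + 1)) := by
    ext j k
    refine Fin.lastCases ?_ (fun k => ?_) k
    · simp only [Matrix.submatrix_apply, finRotate_last, colMatrix, hA, Matrix.of_apply, id,
        Fin.cons_zero, Fin.val_last]
      congr 1; push_cast; ring
    · rw [Matrix.submatrix_apply, finRotate_apply, Fin.coeSucc_eq_succ]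
      simp only [colMatrix, hA, Matrix.of_apply, id, Fin.cons_succ, Fin.val_castSucc]
      congr 1; push_cast; ring
  have h2 : (colMatrix V fun k => i + k) = A.updateCol 0 fun j =>
      ∑ k, (Fin.cons (-d (N + 1) i) fun k : Fin N => -d (k + 1) i : Fin (N + 1) → K) k • A j k := by
    ext j k
    refine Fin.cases ?_ (fun k => ?_) k
    · have := hV j i
      rw [Finset.sum_range_succ, Finset.sum_range_succ', hd0, Finset.sum_range] at this
      rw [Matrix.updateCol_self, Fin.sum_univ_succ]
      simp only [colMatrix, hA, Matrix.of_apply, Fin.cons_zero, Fin.cons_succ, smul_eq_mul,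
        neg_mul, Finset.sum_neg_distrib, Fin.val_zero]
      simp only [Nat.cast_zero, one_mul] at this
      linear_combination this
    · rw [Matrix.updateCol_ne (Fin.succ_ne_zero k)]
      simp [colMatrix, hA]
  rw [h2, Matrix.det_updateCol_sum, h1, Matrix.det_permute', sign_finRotate, Fin.cons_zero, hdM]
  simp [pow_succ]

/-- Nonzero end coefficients allow the recurrence to be solved in both directions. -/
theorem eq_zero_of_consecutive {M : ℕ} {d : ℕ → ℤ → K} (hd0 : ∀ i, d 0 i ≠ 0)
    (hdM : ∀ i, d M i ≠ 0) {y : ℤ → K}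
    (hy : ∀ i, ∑ k ∈ Finset.range (M + 1), d k i * y (i + k) = 0)
    (h : ∀ k < M, y k = 0) (i : ℤ) : y i = 0 := by
  have hz : ∀ i : ℤ, ∀ k < M, y (i + k) = 0 := fun i => by
    induction i using Int.induction_on with
    | zero => simpa using h
    | succ n ih =>
      intro k hk
      rcases Nat.lt_or_ge (k + 1) M with hk' | hk'
      · rw [← ih _ hk']; congr 1; push_cast; ring
      · obtain rfl : M = k + 1 := by omega
        have := hy n
        rw [Finset.sum_range_succ, Finset.sum_eq_zero fun l hl => by
          rw [ih l (Finset.mem_range.mp hl), mul_zero], zero_add] at this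
        rw [← (mul_eq_zero.mp this).resolve_left (hdM _)]; congr 1; push_cast; ring
    | pred n ih =>
      intro k hk
      rcases k with _ | k
      · have := hy (-n - 1)
        rw [Finset.sum_range_succ', Finset.sum_eq_zero fun l hl => by
          rw [show (-n - 1 : ℤ) + (l + 1 : ℕ) = -n + l by push_cast; ring,
            ih l (Finset.mem_range.mp hl), mul_zero], zero_add] at this
        exact (mul_eq_zero.mp this).resolve_left (hd0 _)
      · rw [← ih k (by omega)]; congr 1; push_cast; ring
  rcases Nat.eq_zero_or_pos M with rfl | hM
  · simpa [hd0 i] using hy i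
  · simpa using hz i 0 hM

end Sequences

/-! ### Solutions of L restricted to a lattice u + 2ℤ -/

section Solutions

variable {K : Type*} [Field K]

/-- The values of the functions `w_j` along the lattice `u + 2ℤ`. -/
def latticeValues {N : ℕ} (w : Fin (N + 1) → ℂ → K) (u : ℂ) (i : ℤ) (j : Fin (N + 1)) : K :=
  w j (u + 2 * i)

theorem casorati_eq_det {N : ℕ} (w : Fin (N + 1) → ℂ → K) (u : ℂ) (i : ℤ)
    (p : Fin (N + 1) → ℤ) :
    (colMatrix (latticeValues w u) fun k => i + p k).det = casorati w p (u + 2 * i) := by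
  rw [casorati]
  congr 1
  ext j k
  simp only [colMatrix, latticeValues, Matrix.of_apply]
  congr 1
  push_cast
  ring

/-- The signed coefficients of `L` along the lattice `u + 2ℤ`. -/
noncomputable def latticeCoeff (Q : ℕ → ℂ → K) (ħ : ℂ) (N : ℕ) (u : ℂ) (k : ℕ) (i : ℤ) : K :=
  (-1) ^ k * shiftElem (x Q ħ N) (N + 1) k (u + 2 * i)

theorem latticeCoeff_zero (Q : ℕ → ℂ → K) (ħ : ℂ) (N : ℕ) (u : ℂ) (i : ℤ) :
    latticeCoeff Q ħ N u 0 i = 1 := by simp [latticeCoeff]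

theorem latticeCoeff_eq_zero (Q : ℕ → ℂ → K) (ħ : ℂ) (N : ℕ) (u : ℂ) (k : ℕ) (hk : N + 1 < k)
    (i : ℤ) : latticeCoeff Q ħ N u k i = 0 := by
  rw [latticeCoeff, shiftElem_eq_zero _ hk, mul_zero]

variable {N : ℕ} {ħ : ℂ} {Q : ℕ → ℂ → K}

theorem shiftElem_x_dual (hQ : ∀ a, 1 ≤ a → a ≤ numOrbits N → ∀ u, Q a u ≠ 0)
    (hper : ∀ a, 1 ≤ a → a ≤ numOrbits N →
      ∃ h : K, ∀ u, Q a (u + (Real.pi : ℂ) * Complex.I / ħ) = h * Q a u)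
    (j k : ℕ) (hjk : j + k = N + 1) (u : ℂ) :
    shiftElem (x Q ħ N) (N + 1) k (u + (N + 1 : ℕ) + halfPeriod ħ) =
      shiftElem (x Q ħ N) (N + 1) j (u + 2 * k) := by
  rw [shiftElem_congr (x_eq_boxVar Q ħ N), shiftElem_congr (x_eq_boxVar Q ħ N)]
  exact shiftElem_boxVar_dual (foldedY_zero Q ħ N) (fun a _ => foldedY_ne_zero hQ a)
    (foldedY_dual hQ hper) j k hjk u

theorem latticeCoeff_top (hQ : ∀ a, 1 ≤ a → a ≤ numOrbits N → ∀ u, Q a u ≠ 0)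
    (hper : ∀ a, 1 ≤ a → a ≤ numOrbits N →
      ∃ h : K, ∀ u, Q a (u + (Real.pi : ℂ) * Complex.I / ħ) = h * Q a u)
    (u : ℂ) (i : ℤ) : latticeCoeff Q ħ N u (N + 1) i = (-1) ^ (N + 1) := by
  have h := shiftElem_x_dual hQ hper (N + 1) 0 rfl (u + 2 * i)
  rw [shiftElem_zero_right, Nat.cast_zero, mul_zero, add_zero] at h
  rw [latticeCoeff, ← h, mul_one]

theorem solutions_recurrence (w : solutions Q ħ N) (u : ℂ) :
    ∑ k ∈ Finset.range (N + 1 + 1),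
      (-1) ^ k * shiftElem (x Q ħ N) (N + 1) k u * (w : ℂ → K) (u + 2 * k) = 0 := by
  rw [← LProd_apply]
  exact congrFun (LinearMap.mem_ker.mp w.2) u

theorem latticeValues_recurrence {w : Fin (N + 1) → ℂ → K} (hw : ∀ j, w j ∈ solutions Q ħ N)
    (u : ℂ) (j : Fin (N + 1)) (i : ℤ) :
    ∑ k ∈ Finset.range (N + 1 + 1), latticeCoeff Q ħ N u k i * latticeValues w u (i + k) j = 0 := by
  rw [← solutions_recurrence ⟨w j, hw j⟩ (u + 2 * i)]
  refine Finset.sum_congr rfl fun k _ => ?_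
  rw [latticeCoeff, latticeValues]
  congr 2
  push_cast
  ring

/-- The shifted solutions satisfy the adjoint recurrence. -/
theorem latticeValues_adjoint_recurrence
    (hQ : ∀ a, 1 ≤ a → a ≤ numOrbits N → ∀ u, Q a u ≠ 0)
    (hper : ∀ a, 1 ≤ a → a ≤ numOrbits N →
      ∃ h : K, ∀ u, Q a (u + (Real.pi : ℂ) * Complex.I / ħ) = h * Q a u)
    {w : Fin (N + 1) → ℂ → K} (hw : ∀ j, w j ∈ solutions Q ħ N)
    (u : ℂ) (j : Fin (N + 1)) (i : ℤ) :
    ∑ k ∈ Finset.range (N + 1 + 1), latticeCoeff Q ħ N u k (i - k) *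
      latticeValues w (u + (N + 1 : ℕ) + halfPeriod ħ) (i - k) j = 0 := by
  -- Read in reverse order, L w = 0 at this point is the adjoint sum up to sign: with l = M - k,
  -- duality turns e_l here into e_k(u + 2(i - k)).
  have h := solutions_recurrence ⟨w j, hw j⟩
    (u + 2 * (i - (N + 1 : ℕ)) + (N + 1 : ℕ) + halfPeriod ħ)
  rw [← Finset.sum_range_reflect] at h
  rw [← mul_zero ((-1 : K) ^ (N + 1)), ← h, Finset.mul_sum]
  refine Finset.sum_congr rfl fun k hk => ?_
  obtain ⟨l, hl⟩ := Nat.exists_eq_add_of_le (Nat.lt_succ_iff.mp (Finset.mem_range.mp hk))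
  have hl' : ((N + 1 : ℕ) : ℂ) = k + l := by rw [hl]; push_cast; ring
  rw [show N + 1 + 1 - 1 - k = l by omega, shiftElem_x_dual hQ hper k l hl.symm, latticeCoeff,
    latticeValues, ← mul_assoc, ← mul_assoc]
  have hs : (-1 : K) ^ (N + 1) * (-1) ^ l = (-1) ^ k := by
    rw [hl, pow_add, mul_assoc, ← mul_pow]; simp
  rw [hs, hl']
  congr 2
  · congr 1; push_cast; ring
  · push_cast; ring

/-- A zero of ξ at u gives a constant combination of the solutions vanishing at M consecutive
lattice points, hence on all of u + 2ℤ; cutting its coefficients off outside the lattice keeps them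
2-periodic and contradicts independence. -/
theorem xi_ne_zero (hQ : ∀ a, 1 ≤ a → a ≤ numOrbits N → ∀ u, Q a u ≠ 0)
    (hper : ∀ a, 1 ≤ a → a ≤ numOrbits N →
      ∃ h : K, ∀ u, Q a (u + (Real.pi : ℂ) * Complex.I / ħ) = h * Q a u)
    {b : Fin (N + 1) → solutions Q ħ N} (hb : LinearIndependent (periodicRing K) b) (u : ℂ) :
    xi (fun j => (b j : ℂ → K)) u ≠ 0 := by
  intro h0
  obtain ⟨v, hv0, hv⟩ := Matrix.exists_vecMul_eq_zero_iff.mpr h0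
  have hvan : ∀ i : ℤ, ∑ j, v j * latticeValues (fun j => (b j : ℂ → K)) u i j = 0 := by
    refine eq_zero_of_consecutive (M := N + 1) (d := latticeCoeff Q ħ N u)
      (fun i => by rw [latticeCoeff_zero]; exact one_ne_zero)
      (fun i => by rw [latticeCoeff_top hQ hper]; simp) (fun i => ?_) fun k hk => ?_
    · simp_rw [Finset.mul_sum]
      rw [Finset.sum_comm]
      refine Finset.sum_eq_zero fun j _ => ?_
      simp_rw [mul_left_comm _ (v j)]
      rw [← Finset.mul_sum, latticeValues_recurrence (fun j => (b j).2), mul_zero]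
    · exact congrFun hv ⟨k, hk⟩
  classical
  let c : Fin (N + 1) → periodicRing K := fun j =>
    ⟨fun z => if ∃ i : ℤ, z = u + 2 * i then v j else 0, fun z => by
      have : (∃ i : ℤ, z + 2 = u + 2 * i) ↔ ∃ i : ℤ, z = u + 2 * i :=
        ⟨fun ⟨i, hi⟩ => ⟨i - 1, by push_cast; linear_combination hi⟩,
          fun ⟨i, hi⟩ => ⟨i + 1, by push_cast; linear_combination hi⟩⟩
      simp only [this]⟩
  have hc : ∑ j, c j • b j = 0 := by
    ext z
    have : ((∑ j, c j • b j : solutions Q ħ N) : ℂ → K) z =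
        ∑ j, (c j : ℂ → K) z * (b j : ℂ → K) z := by
      rw [Submodule.coe_sum, Finset.sum_apply]
      rfl
    rw [this]
    by_cases hz : ∃ i : ℤ, z = u + 2 * i
    · obtain ⟨i, rfl⟩ := hz
      refine Eq.trans ?_ (hvan i)
      refine Finset.sum_congr rfl fun j _ => ?_
      simp only [c, latticeValues]
      rw [if_pos ⟨i, rfl⟩]
    · exact Finset.sum_eq_zero fun j _ => by simp only [c, if_neg hz, zero_mul]
  refine hv0 (funext fun j => ?_)
  have := congrFun (congrArg Subtype.val (Fintype.linearIndependent_iff.mp hb c hc j)) u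
  simp only [c] at this
  rwa [if_pos ⟨0, by simp⟩] at this

theorem xi_add_two_mul_int (hQ : ∀ a, 1 ≤ a → a ≤ numOrbits N → ∀ u, Q a u ≠ 0)
    (hper : ∀ a, 1 ≤ a → a ≤ numOrbits N →
      ∃ h : K, ∀ u, Q a (u + (Real.pi : ℂ) * Complex.I / ħ) = h * Q a u)
    {w : Fin (N + 1) → ℂ → K} (hw : ∀ j, w j ∈ solutions Q ħ N) (u : ℂ) (i : ℤ) :
    xi w (u + 2 * i) = xi w u := by
  have h := eq_of_add_one_eq (f := fun i => (colMatrix (latticeValues w u) fun k => i + k).det)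
    (det_consecutive (latticeCoeff_zero Q ħ N u)
    (latticeCoeff_top hQ hper u) (latticeValues_recurrence hw u)) i 0
  simp only [casorati_eq_det] at h
  simpa [xi] using h

end Solutions

end TwistedA

theorem mainTheorem8 {K : Type*} [Field K] (N : ℕ) (hN : 2 ≤ N) (ħ : ℂ) (hħ : ħ ≠ 0)
    (Q : ℕ → ℂ → K)
    (hQ : ∀ a, 1 ≤ a → a ≤ TwistedA.numOrbits N → ∀ u, Q a u ≠ 0)
    (hper : ∀ a, 1 ≤ a → a ≤ TwistedA.numOrbits N →
      ∃ h : K, ∀ u, Q a (u + (Real.pi : ℂ) * Complex.I / ħ) = h * Q a u)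
    (b : Module.Basis (Fin (N + 1)) (TwistedA.periodicRing K) (TwistedA.solutions Q ħ N))
    (w : Fin (N + 1) → ℂ → K) (hw : ∀ j, w j = (b j : ℂ → K))
    (a : ℕ) (ha : a ≤ N + 1) (m : ℤ) (u : ℂ) :
    TwistedA.xi w u ≠ 0 ∧
    TwistedA.xi w (u + 2 * a - N - 1 + (Real.pi : ℂ) * Complex.I / (2 * ħ)) ≠ 0 ∧
    TwistedA.xiRect w a m u / TwistedA.xi w u =
      TwistedA.xiRect w (N + 1 - a) m
          (u + 2 * a - N - 1 + (Real.pi : ℂ) * Complex.I / (2 * ħ)) /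
        TwistedA.xi w (u + 2 * a - N - 1 + (Real.pi : ℂ) * Complex.I / (2 * ħ)) := by
  open TwistedA in
  obtain rfl : w = fun j => (b j : ℂ → K) := funext hw
  set w : Fin (N + 1) → ℂ → K := fun j => (b j : ℂ → K)
  have hsol : ∀ j, w j ∈ solutions Q ħ N := fun j => (b j).2
  have hne : ∀ u, xi w u ≠ 0 := xi_ne_zero hQ hper b.linearIndependent
  refine ⟨hne _, hne _, ?_⟩
  rw [div_eq_div_iff (hne _) (hne _)]
  set u' := u + (N + 1 : ℕ) + halfPeriod ħ with hu'
  have htop := latticeCoeff_top hQ hper u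
  obtain ⟨X, hX, h0, h1⟩ := exists_pairing (latticeCoeff_eq_zero Q ħ N u)
    (fun i => by rw [htop]; simp) (fun i j => by rw [htop, htop]) (Nat.succ_pos N)
    (latticeValues_recurrence hsol u) (latticeValues_adjoint_recurrence hQ hper hsol u)
    (fun i => by rw [casorati_eq_det]; exact hne _)
    (fun i => by rw [casorati_eq_det]; exact hne _)
  have h := det_blocks_eq hX h0 h1 a ha m
  have hz := casorati_eq_det w u 0 fun k => if (k : ℕ) < a then (k : ℤ) else k + m
  simp only [zero_add] at hz
  rw [hz, casorati_eq_det, casorati_eq_det, casorati_eq_det] at h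
  change xi w _ * _ = xiRect w (N + 1 - a) m _ * xi w _ at h
  rw [xi_add_two_mul_int hQ hper hsol, xi_add_two_mul_int hQ hper hsol] at h
  -- The gapped block of V' starts at a - M, and (M + p) + 2(a - M) = 2a - N - 1 + p.
  have hpt : u + 2 * a - N - 1 + (Real.pi : ℂ) * Complex.I / (2 * ħ) =
      u' + 2 * ((a - (N + 1 : ℕ) : ℤ) : ℂ) := by
    rw [hu', halfPeriod]
    push_cast
    ring
  rw [hpt, xi_add_two_mul_int hQ hper hsol, ← h, mul_comm, xiRect]
  simp [hu']
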